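/- Call a set $A$ of positive integers \emph{free of geometric progressions} if there are no three elements of $A$ of the form $a, ak, ak^2$ with $k\in\mathbb{Q}$, $k>1$. Let \[\overline{\alpha}=\sup\{\bar d(A) : A\subset\{1,2,3,\dots\}\text{ is free of geometric progressions}\},\] where $\bar d(A)=\limsup_{N\to\infty}\frac{|A\cap\{1,\dots,N\}|}{N}$ is the upper asymptotic density. For integers $s\ge 2$ and $N\ge 1$ let $g_s(N)$ be the largest cardinality of a subset of $\{1,\dots,N\}$ which contains no three elements of the form $a,ak,ak^2$ with $k\in\mathbb{Q}$, $k>1$, such that every prime dividing the numerator or the denominator of $k$ (in lowest terms) is at most $s$. \textbf{Theorem.} For every integer $s\ge 2$ the limit $\overline{\alpha_s}=\lim_{N\to\infty}\frac{g_s(N)}{N}$ exists, and \[\lim_{s\to\infty}\overline{\alpha_s}=\overline{\alpha}.\] -/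

import Mathlib

open Filter Topology

noncomputable section

namespace GeomProg

/-- The set `A` contains no three-term geometric progression `(a, a k, a k ^ 2)` whose common
ratio is a rational number `k > 1` belonging to `R`. -/
def FreeOfRatios (R : Set ℚ) (A : Set ℕ) : Prop :=
  ¬ ∃ a ∈ A, ∃ b ∈ A, ∃ c ∈ A, ∃ k ∈ R, 1 < k ∧ (b : ℚ) = a * k ∧ (c : ℚ) = a * k ^ 2

/-- `A` is free of three-term geometric progressions with rational ratio. -/
def GPFree (A : Set ℕ) : Prop := FreeOfRatios Set.univ A

/-- The rational numbers involving only primes `p ≤ s`: every prime that divides the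
numerator or the denominator in lowest terms is at most `s`. -/
def smoothRatios (s : ℕ) : Set ℚ :=
  {k | ∀ p : ℕ, p.Prime → (p ∣ k.num.natAbs ∨ p ∣ k.den) → p ≤ s}

open Classical in
/-- Upper asymptotic density of a set of positive integers. -/
def upperDensity (A : Set ℕ) : ℝ :=
  limsup (fun N : ℕ => (((Finset.Icc 1 N).filter (fun n => n ∈ A)).card : ℝ) / (N : ℝ)) atTop

/-- The supremum of the upper densities of the sets of positive integers that are free of
three-term geometric progressions with rational ratio. -/
def alphaBar : ℝ :=
  sSup {d : ℝ | ∃ A : Set ℕ, (∀ n ∈ A, 0 < n) ∧ GPFree A ∧ d = upperDensity A}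

open Classical in
/-- The largest cardinality of a subset of `{1, …, N}` that is free of three-term geometric
progressions whose ratio involves only primes `p ≤ s`. -/
def g (s N : ℕ) : ℕ :=
  ((Finset.Icc 1 N).powerset.filter
    (fun A : Finset ℕ => FreeOfRatios (smoothRatios s) (A : Set ℕ))).sup Finset.card

/-- The limit of `g s N / N` as `N → ∞`. -/
def alphaBarSmooth (s : ℕ) : ℝ :=
  limUnder atTop (fun N : ℕ => (g s N : ℝ) / (N : ℝ))

end GeomProg

end

namespace GeomProg

/-! Existence of the limit: write each integer as `t * m` with `t` composed of primes at most `s`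
and `m` coprime to `s!`. An admissible ratio fixes `m`, so the extremal problem splits into
independent problems on the smooth `t ≤ N / m` (`g_eq_sum`). Regrouping by the jumps of the smooth
extremal function (`g_eq_tsum`) leaves counts of rough numbers, which have a density by periodicity.
The jumps live on smooth numbers, whose reciprocals are summable, so dominated convergence applies.

Limit in `s`: `alphaBar ≤ alphaBarSmooth s` because forbidding fewer ratios only helps. Conversely,
a ratio involving a prime `p > s` makes `p ^ 2` divide an end term; deleting all such multiples from
a finite extremal set costs at most `N / s` and leaves no progressions (`exists_gpFree_card_ge`).
Such sets at rapidly growing scales are glued into one infinite set, with negligible loss at each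
scale (`gpFree_glue`, `density_glue_ge`). Hence `alphaBarSmooth s - 1 / s ≤ alphaBar`. -/

theorem FreeOfRatios.mono {R : Set ℚ} {A B : Set ℕ} (h : FreeOfRatios R B) (hAB : A ⊆ B) :
    FreeOfRatios R A := by
  rintro ⟨a, ha, b, hb, c, hc, hk⟩
  exact h ⟨a, hAB ha, b, hAB hb, c, hAB hc, hk⟩

theorem FreeOfRatios.empty (R : Set ℚ) : FreeOfRatios R ∅ := by
  rintro ⟨a, ha, -⟩
  exact ha

open Classical in
/-- The largest cardinality of a subset of `T` without progressions with ratio in `R`. -/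
noncomputable def maxFree (R : Set ℚ) (T : Finset ℕ) : ℕ :=
  (T.powerset.filter (fun A : Finset ℕ => FreeOfRatios R (A : Set ℕ))).sup Finset.card

theorem card_le_maxFree {R : Set ℚ} {T A : Finset ℕ} (hA : A ⊆ T)
    (h : FreeOfRatios R (A : Set ℕ)) : A.card ≤ maxFree R T := by
  classical
  exact Finset.le_sup (f := Finset.card) (by simpa using ⟨hA, h⟩)

theorem exists_card_eq_maxFree (R : Set ℚ) (T : Finset ℕ) :
    ∃ A ⊆ T, FreeOfRatios R (A : Set ℕ) ∧ A.card = maxFree R T := by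
  classical
  obtain ⟨A, hA, h⟩ := Finset.exists_mem_eq_sup
    (T.powerset.filter (fun A : Finset ℕ => FreeOfRatios R (A : Set ℕ)))
    ⟨∅, by simpa using FreeOfRatios.empty R⟩ Finset.card
  simp only [Finset.mem_filter, Finset.mem_powerset] at hA
  exact ⟨A, hA.1, hA.2, h.symm⟩

theorem maxFree_mono (R : Set ℚ) {S T : Finset ℕ} (h : S ⊆ T) : maxFree R S ≤ maxFree R T := by
  obtain ⟨A, hA, hf, hc⟩ := exists_card_eq_maxFree R S
  exact hc ▸ card_le_maxFree (hA.trans h) hf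

theorem maxFree_insert_le (R : Set ℚ) (T : Finset ℕ) (x : ℕ) :
    maxFree R (insert x T) ≤ maxFree R T + 1 := by
  obtain ⟨A, hA, hf, hc⟩ := exists_card_eq_maxFree R (insert x T)
  have h1 : (A.erase x).card ≤ maxFree R T := by
    refine card_le_maxFree (fun y hy => ?_) (hf.mono (by simp))
    rw [Finset.mem_erase] at hy
    exact (Finset.mem_insert.1 (hA hy.2)).resolve_left hy.1
  have h2 := Finset.pred_card_le_card_erase (s := A) (a := x)
  omega

theorem g_eq_maxFree (s N : ℕ) : g s N = maxFree (smoothRatios s) (Finset.Icc 1 N) := rfl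

/-! ### Decomposition into smooth and rough parts -/

/-- The shift to `s + 1` is needed because `Nat.smoothNumbers` bounds primes strictly. -/
theorem mem_smoothNumbers_succ {s t : ℕ} :
    t ∈ Nat.smoothNumbers (s + 1) ↔ ∀ p : ℕ, p.Prime → p ∣ t → p ≤ s := by
  simp [Nat.mem_smoothNumbers']

theorem coprime_of_mem_smoothNumbers {s t m : ℕ} (ht : t ∈ Nat.smoothNumbers (s + 1))
    (hm : m.Coprime s.factorial) : t.Coprime m := by
  refine Nat.coprime_of_dvd fun p hp hpt hpm => ?_
  have h := (hp.dvd_factorial).2 (mem_smoothNumbers_succ.1 ht p hp hpt)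
  exact hp.one_lt.ne' (Nat.dvd_one.1 (hm ▸ Nat.dvd_gcd hpm h))

theorem exists_smooth_mul_rough (s : ℕ) {n : ℕ} (hn : n ≠ 0) :
    ∃ t ∈ Nat.smoothNumbers (s + 1), ∃ m, m.Coprime s.factorial ∧ n = t * m := by
  induction n using induction_on_primes with
  | zero => exact absurd rfl hn
  | one => exact ⟨1, by simp [Nat.mem_smoothNumbers], 1, by simp, rfl⟩
  | prime_mul p a hp ih =>
    obtain ⟨t, ht, m, hm, rfl⟩ := ih (right_ne_zero_of_mul hn)
    by_cases hps : p ≤ s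
    · refine ⟨p * t, Nat.mul_mem_smoothNumbers ?_ ht, m, hm, by ring⟩
      exact Nat.mem_smoothNumbers_of_lt hp.pos (by omega)
    · refine ⟨t, ht, p * m, Nat.Coprime.mul_left ?_ hm, by ring⟩
      exact (hp.coprime_iff_not_dvd).2 fun h => hps (hp.dvd_factorial.1 h)

theorem smooth_mul_rough_unique {s t t' m m' : ℕ} (ht : t ∈ Nat.smoothNumbers (s + 1))
    (ht' : t' ∈ Nat.smoothNumbers (s + 1)) (hm : m.Coprime s.factorial)
    (hm' : m'.Coprime s.factorial) (h : t * m = t' * m') : t = t' ∧ m = m' := by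
  have h1 : t ∣ t' := (coprime_of_mem_smoothNumbers ht hm').dvd_of_dvd_mul_right
    (h ▸ Dvd.intro m rfl)
  have h2 : t' ∣ t := (coprime_of_mem_smoothNumbers ht' hm).dvd_of_dvd_mul_right
    (h ▸ Dvd.intro m' rfl)
  have h3 := Nat.dvd_antisymm h1 h2
  subst h3
  exact ⟨rfl, Nat.eq_of_mul_eq_mul_left (Nat.pos_of_ne_zero (Nat.ne_zero_of_mem_smoothNumbers ht)) h⟩

theorem num_den_mem_smoothNumbers {s : ℕ} {k : ℚ} (hk : k ∈ smoothRatios s) :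
    k.num.natAbs ∈ Nat.smoothNumbers (s + 1) ∧ k.den ∈ Nat.smoothNumbers (s + 1) :=
  ⟨mem_smoothNumbers_succ.2 fun p hp h => hk p hp (Or.inl h),
    mem_smoothNumbers_succ.2 fun p hp h => hk p hp (Or.inr h)⟩

theorem mul_den_eq_mul_num {a b : ℕ} {k : ℚ} (hk : 0 < k) (h : (b : ℚ) = a * k) :
    b * k.den = a * k.num.natAbs := by
  have hd : (k.den : ℚ) ≠ 0 := by exact_mod_cast k.den_nz
  have hn : ((k.num.natAbs : ℕ) : ℚ) = k.num := by
    rw [← Int.cast_natCast, Int.natAbs_of_nonneg (Rat.num_pos.2 hk).le]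
  have h1 : (b : ℚ) * k.den = a * k.num.natAbs := by
    rw [h, hn, mul_assoc, Rat.mul_den_eq_num]
  exact_mod_cast h1

/-- Clearing the denominator of `k` multiplies only the smooth parts by smooth factors; unique
decomposition then identifies the rough parts. -/
theorem rough_eq_of_ratio {s t t' m m' : ℕ} (ht : t ∈ Nat.smoothNumbers (s + 1))
    (ht' : t' ∈ Nat.smoothNumbers (s + 1)) (hm : m.Coprime s.factorial)
    (hm' : m'.Coprime s.factorial) {k : ℚ} (hk : k ∈ smoothRatios s) (hk0 : 0 < k)
    (h : ((t' * m' : ℕ) : ℚ) = (t * m : ℕ) * k) : m = m' := by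
  obtain ⟨h1, h2⟩ := num_den_mem_smoothNumbers hk
  refine (smooth_mul_rough_unique (Nat.mul_mem_smoothNumbers ht h1)
    (Nat.mul_mem_smoothNumbers ht' h2) hm hm' ?_).2
  have := mul_den_eq_mul_num hk0 h
  linarith

open Classical in
/-- The numbers up to `x` all of whose prime factors are at most `s`. -/
noncomputable def smoothUpTo (s x : ℕ) : Finset ℕ :=
  (Finset.Icc 1 x).filter (· ∈ Nat.smoothNumbers (s + 1))

theorem mem_smoothUpTo {s x t : ℕ} :
    t ∈ smoothUpTo s x ↔ t ≤ x ∧ t ∈ Nat.smoothNumbers (s + 1) := by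
  simp only [smoothUpTo, Finset.mem_filter, Finset.mem_Icc]
  refine ⟨fun h => ⟨h.1.2, h.2⟩, fun h => ⟨⟨?_, h.1⟩, h.2⟩⟩
  exact Nat.pos_of_ne_zero (Nat.ne_zero_of_mem_smoothNumbers h.2)

/-- The numbers up to `x` all of whose prime factors exceed `s`. -/
def roughUpTo (s x : ℕ) : Finset ℕ :=
  (Finset.Icc 1 x).filter (fun m => m.Coprime s.factorial)

theorem mem_roughUpTo {s x m : ℕ} :
    m ∈ roughUpTo s x ↔ (1 ≤ m ∧ m ≤ x) ∧ m.Coprime s.factorial := by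
  simp [roughUpTo]

theorem freeOfRatios_of_dilate {R : Set ℚ} {A B : Set ℕ} {m : ℕ} (h : FreeOfRatios R A)
    (hB : ∀ t ∈ B, t * m ∈ A) : FreeOfRatios R B := by
  rintro ⟨a, ha, b, hb, c, hc, k, hk, hk1, h1, h2⟩
  refine h ⟨_, hB a ha, _, hB b hb, _, hB c hc, k, hk, hk1, ?_, ?_⟩
  · push_cast; rw [h1]; ring
  · push_cast; rw [h2]; ring

theorem g_le_sum (s N : ℕ) :
    g s N ≤ ∑ m ∈ roughUpTo s N, maxFree (smoothRatios s) (smoothUpTo s (N / m)) := by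
  classical
  obtain ⟨A, hA, hf, hc⟩ := exists_card_eq_maxFree (smoothRatios s) (Finset.Icc 1 N)
  rw [g_eq_maxFree, ← hc]
  have hsub : A ⊆ (roughUpTo s N).biUnion fun m =>
      ((smoothUpTo s (N / m)).filter fun t => t * m ∈ A).image (· * m) := by
    intro n hn
    have hnN := Finset.mem_Icc.1 (hA hn)
    obtain ⟨t, ht, m, hm, rfl⟩ := exists_smooth_mul_rough s (n := n) (by omega)
    have hm0 : 0 < m := Nat.pos_of_mul_pos_left (Nat.lt_of_lt_of_le Nat.zero_lt_one hnN.1)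
    have ht0 := Nat.pos_of_ne_zero (Nat.ne_zero_of_mem_smoothNumbers ht)
    simp only [Finset.mem_biUnion, Finset.mem_image, Finset.mem_filter]
    refine ⟨m, mem_roughUpTo.2 ⟨⟨hm0, by nlinarith⟩, hm⟩, t, ⟨mem_smoothUpTo.2 ⟨?_, ht⟩, hn⟩, rfl⟩
    exact (Nat.le_div_iff_mul_le hm0).2 hnN.2
  refine (Finset.card_le_card hsub).trans (Finset.card_biUnion_le.trans ?_)
  refine Finset.sum_le_sum fun m _ => Finset.card_image_le.trans ?_
  refine card_le_maxFree (Finset.filter_subset _ _) (freeOfRatios_of_dilate (m := m) hf ?_)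
  intro t ht
  simpa using (Finset.mem_filter.1 (Finset.mem_coe.1 ht)).2

/-- Optimal sets chosen separately for each rough part have a progression-free union, since no
admissible ratio links two different rough parts. -/
theorem sum_le_g (s N : ℕ) :
    ∑ m ∈ roughUpTo s N, maxFree (smoothRatios s) (smoothUpTo s (N / m)) ≤ g s N := by
  classical
  choose B hB hf hc using fun m =>
    exists_card_eq_maxFree (smoothRatios s) (smoothUpTo s (N / m))
  have hmem : ∀ {m t}, t ∈ B m → t * m ≤ N ∧ t ∈ Nat.smoothNumbers (s + 1) := by
    intro m t ht
    have h := mem_smoothUpTo.1 (hB m ht)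
    exact ⟨(Nat.mul_le_mul_right m h.1).trans (Nat.div_mul_le_self N m), h.2⟩
  have hpos : ∀ {m}, m ∈ roughUpTo s N → 0 < m := fun h => (mem_roughUpTo.1 h).1.1
  have hcard : ∑ m ∈ roughUpTo s N, maxFree (smoothRatios s) (smoothUpTo s (N / m)) =
      ((roughUpTo s N).biUnion fun m => (B m).image (· * m)).card := by
    rw [Finset.card_biUnion]
    · refine Finset.sum_congr rfl fun m hm => ?_
      rw [← hc m, Finset.card_image_of_injective]
      exact fun x y h => Nat.eq_of_mul_eq_mul_right (hpos hm) h
    · intro m hm m' hm' hne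
      refine Finset.disjoint_left.2 fun n hn hn' => hne ?_
      obtain ⟨t, ht, rfl⟩ := Finset.mem_image.1 hn
      obtain ⟨t', ht', h⟩ := Finset.mem_image.1 hn'
      exact (smooth_mul_rough_unique (hmem ht').2 (hmem ht).2 (mem_roughUpTo.1 hm').2
        (mem_roughUpTo.1 hm).2 h).2.symm
  rw [hcard, g_eq_maxFree]
  refine card_le_maxFree ?_ ?_
  · intro n hn
    obtain ⟨m, hm, hn⟩ := Finset.mem_biUnion.1 hn
    obtain ⟨t, ht, rfl⟩ := Finset.mem_image.1 hn
    exact Finset.mem_Icc.2 ⟨Nat.mul_pos (Nat.pos_of_ne_zero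
      (Nat.ne_zero_of_mem_smoothNumbers (hmem ht).2)) (hpos hm), (hmem ht).1⟩
  · rintro ⟨a, ha, b, hb, c, hc', k, hk, hk1, h1, h2⟩
    simp only [Finset.mem_coe, Finset.mem_biUnion, Finset.mem_image] at ha hb hc'
    obtain ⟨m, hm, t, ht, rfl⟩ := ha
    obtain ⟨m', hm', t', ht', rfl⟩ := hb
    obtain ⟨m'', hm'', t'', ht'', rfl⟩ := hc'
    have hk0 : 0 < k := zero_lt_one.trans hk1
    have e1 := rough_eq_of_ratio (hmem ht).2 (hmem ht').2 (mem_roughUpTo.1 hm).2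
      (mem_roughUpTo.1 hm').2 hk hk0 h1
    subst e1
    have e2 := rough_eq_of_ratio (hmem ht').2 (hmem ht'').2 (mem_roughUpTo.1 hm).2
      (mem_roughUpTo.1 hm'').2 hk hk0 (by rw [h2, h1]; ring)
    subst e2
    have hm0 : (m : ℚ) ≠ 0 := by exact_mod_cast (hpos hm).ne'
    refine hf m ⟨t, ht, t', ht', t'', ht'', k, hk, hk1, ?_, ?_⟩
    · apply mul_right_cancel₀ hm0
      push_cast at h1; rw [h1]; ring
    · apply mul_right_cancel₀ hm0
      push_cast at h2; rw [h2]; ring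

theorem g_eq_sum (s N : ℕ) :
    g s N = ∑ m ∈ roughUpTo s N, maxFree (smoothRatios s) (smoothUpTo s (N / m)) :=
  (g_le_sum s N).antisymm (sum_le_g s N)

/-! ### Existence of the limit -/

/-- The jump at `t + 1` of the largest size of a progression-free set of smooth numbers. -/
noncomputable def jump (s t : ℕ) : ℝ :=
  (maxFree (smoothRatios s) (smoothUpTo s (t + 1)) : ℝ) -
    maxFree (smoothRatios s) (smoothUpTo s t)

theorem maxFree_smoothUpTo_eq_sum (s x : ℕ) :
    (maxFree (smoothRatios s) (smoothUpTo s x) : ℝ) = ∑ t ∈ Finset.range x, jump s t := by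
  have h0 : maxFree (smoothRatios s) (smoothUpTo s 0) = 0 := by
    obtain ⟨A, hA, -, hc⟩ := exists_card_eq_maxFree (smoothRatios s) (smoothUpTo s 0)
    rw [← hc, Finset.card_eq_zero]
    simpa [smoothUpTo] using hA
  simp only [jump]
  rw [Finset.sum_range_sub (fun t => (maxFree (smoothRatios s) (smoothUpTo s t) : ℝ)), h0]
  simp

theorem jump_nonneg (s t : ℕ) : 0 ≤ jump s t := by
  have := maxFree_mono (smoothRatios s) (S := smoothUpTo s t) (T := smoothUpTo s (t + 1))
    fun x hx => by
      rw [mem_smoothUpTo] at hx ⊢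
      exact ⟨by omega, hx.2⟩
  rw [jump, sub_nonneg]
  exact_mod_cast this

theorem jump_le_indicator (s t : ℕ) :
    jump s t ≤ (Nat.smoothNumbers (s + 1)).indicator (fun _ => (1 : ℝ)) (t + 1) := by
  classical
  by_cases h : t + 1 ∈ Nat.smoothNumbers (s + 1)
  · rw [Set.indicator_of_mem h, jump]
    have h1 := (maxFree_mono (smoothRatios s) (S := smoothUpTo s (t + 1))
      (T := insert (t + 1) (smoothUpTo s t)) fun x hx => by
        rw [Finset.mem_insert, mem_smoothUpTo]
        rw [mem_smoothUpTo] at hx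
        by_cases hxt : x = t + 1
        · exact Or.inl hxt
        · exact Or.inr ⟨by omega, hx.2⟩).trans (maxFree_insert_le _ _ _)
    have h2 : (maxFree (smoothRatios s) (smoothUpTo s (t + 1)) : ℝ) ≤
      maxFree (smoothRatios s) (smoothUpTo s t) + 1 := by exact_mod_cast h1
    linarith
  · have : smoothUpTo s (t + 1) = smoothUpTo s t := by
      ext x
      rw [mem_smoothUpTo, mem_smoothUpTo]
      refine and_congr_left fun hx => ?_
      have : x ≠ t + 1 := fun e => h (e ▸ hx)
      omega
    rw [Set.indicator_of_notMem h, jump, this, sub_self]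

/-- The sum is a finite Euler product of convergent geometric series. -/
theorem summable_smooth_inv (s : ℕ) :
    Summable fun t : ℕ =>
      (Nat.smoothNumbers (s + 1)).indicator (fun n : ℕ => ((n : ℝ))⁻¹) (t + 1) := by
  let f : ℕ →* ℝ :=
    { toFun := fun n => ((n : ℝ))⁻¹, map_one' := by simp, map_mul' := fun a b => by
        push_cast; rw [mul_inv] }
  have h := (EulerProduct.summable_and_hasSum_smoothNumbers_prod_primesBelow_geometric (f := f)
    (fun {p} hp => by
      have : (1 : ℝ) < p := by exact_mod_cast hp.one_lt
      simpa [f] using inv_lt_one_of_one_lt₀ this) (s + 1)).2.summable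
  exact (summable_nat_add_iff 1).2 (summable_subtype_iff_indicator.1 h)

theorem exists_tendsto_rough_density (s : ℕ) :
    ∃ ρ : ℝ, Tendsto (fun y : ℕ => ((roughUpTo s y).card : ℝ) / y) atTop (𝓝 ρ) := by
  set M := s.factorial
  have hM : 0 < M := s.factorial_pos
  let p : ℕ → Prop := fun i => (i + 1).Coprime M
  have hcard : ∀ y, (roughUpTo s y).card = Nat.count p y := by
    intro y
    rw [Nat.count_eq_card_filter_range]
    refine (Finset.card_bij (fun i _ => i + 1) ?_ ?_ ?_).symm
    · intro i hi
      simp only [Finset.mem_filter, Finset.mem_range, p] at hi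
      exact mem_roughUpTo.2 ⟨⟨by omega, by omega⟩, hi.2⟩
    · intro i _ j _ h
      omega
    · intro m hm
      obtain ⟨⟨h1, h2⟩, h3⟩ := mem_roughUpTo.1 hm
      refine ⟨m - 1, ?_, by omega⟩
      simp only [Finset.mem_filter, Finset.mem_range, p]
      rw [Nat.sub_add_cancel h1]
      exact ⟨by omega, h3⟩
  let ρ : ℝ := (Nat.count p M : ℝ) / M
  -- Coprimality to `s!` is periodic, so this discrepancy is periodic too, hence bounded.
  let f : ℕ → ℝ := fun y => (Nat.count p y : ℝ) - ρ * y
  have hM' : (M : ℝ) ≠ 0 := by exact_mod_cast hM.ne'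
  have hper : Function.Periodic f M := by
    intro y
    have h1 : Nat.count p (y + M) = Nat.count p M + Nat.count p y := by
      rw [add_comm, Nat.count_add]
      congr 1
      have : (fun k => p (M + k)) = p := by
        funext k
        simp only [p, add_assoc, Nat.coprime_self_add_left]
      simp only [this]
    simp only [f, h1, ρ]
    push_cast
    field_simp
    ring
  have hbdd : ∀ y, |f y| ≤ ∑ i ∈ Finset.range M, |f i| := by
    intro y
    rw [← hper.map_mod_nat y]
    exact Finset.single_le_sum (f := fun i => |f i|) (fun i _ => abs_nonneg _)
      (Finset.mem_range.2 (Nat.mod_lt y hM))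
  refine ⟨ρ, ?_⟩
  have h0 : Tendsto (fun y : ℕ => f y / y) atTop (𝓝 0) := by
    refine squeeze_zero_norm (fun y => ?_)
      (tendsto_const_div_atTop_nhds_zero_nat (∑ i ∈ Finset.range M, |f i|))
    rw [norm_div, Real.norm_eq_abs, Real.norm_natCast]
    exact div_le_div_of_nonneg_right (hbdd y) (Nat.cast_nonneg y)
  have h1 := h0.add_const ρ
  rw [zero_add] at h1
  refine h1.congr' ?_
  filter_upwards [eventually_gt_atTop 0] with y hy
  have : (y : ℝ) ≠ 0 := by exact_mod_cast hy.ne'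
  rw [hcard]
  simp only [f]
  field_simp
  ring

/-- Expand each block maximum into jumps and swap sums: `t < N / m` and `m ≤ N / (t + 1)` both say
`(t + 1) * m ≤ N`. -/
theorem g_eq_tsum (s N : ℕ) :
    (g s N : ℝ) = ∑' t, jump s t * (roughUpTo s (N / (t + 1))).card := by
  rw [tsum_eq_sum (s := Finset.range N)]
  · rw [g_eq_sum]
    push_cast
    simp_rw [maxFree_smoothUpTo_eq_sum, mul_comm (jump s _), ← nsmul_eq_mul, ← Finset.sum_const]
    refine Finset.sum_comm' (fun (m t : ℕ) => ?_)
    rw [Finset.mem_range, Finset.mem_range, mem_roughUpTo, mem_roughUpTo]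
    constructor
    · rintro ⟨⟨⟨h1, h2⟩, h3⟩, h4⟩
      have h5 := (Nat.le_div_iff_mul_le h1).1 h4
      refine ⟨⟨⟨h1, (Nat.le_div_iff_mul_le t.succ_pos).2 ?_⟩, h3⟩, by nlinarith⟩
      rw [mul_comm]; exact h5
    · rintro ⟨⟨⟨h1, h2⟩, h3⟩, h4⟩
      have h5 := (Nat.le_div_iff_mul_le t.succ_pos).1 h2
      refine ⟨⟨⟨h1, by nlinarith⟩, h3⟩, (Nat.le_div_iff_mul_le h1).2 ?_⟩
      rw [mul_comm]; exact h5
  · intro t ht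
    have : N / (t + 1) = 0 := Nat.div_eq_of_lt (by simpa [Nat.lt_succ_iff] using ht)
    simp [this, roughUpTo]

theorem card_roughUpTo_le (s x : ℕ) : (roughUpTo s x).card ≤ x :=
  (Finset.card_filter_le _ _).trans (by simp)

theorem tendsto_rough_div (s : ℕ) {ρ : ℝ}
    (h : Tendsto (fun y : ℕ => ((roughUpTo s y).card : ℝ) / y) atTop (𝓝 ρ)) (t : ℕ) :
    Tendsto (fun N : ℕ => ((roughUpTo s (N / (t + 1))).card : ℝ) / N) atTop
      (𝓝 (ρ * ((t + 1 : ℕ) : ℝ)⁻¹)) := by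
  have hdiv : Tendsto (fun N : ℕ => N / (t + 1)) atTop atTop :=
    Nat.tendsto_div_const_atTop t.succ_ne_zero
  have h1 : Tendsto (fun N : ℕ => ((N / (t + 1) : ℕ) : ℝ) / N) atTop
      (𝓝 (((t + 1 : ℕ) : ℝ)⁻¹)) := by
    have := (tendsto_nat_floor_mul_div_atTop (R := ℝ) (a := ((t + 1 : ℕ) : ℝ)⁻¹)
      (by positivity)).comp (tendsto_natCast_atTop_atTop (R := ℝ))
    refine this.congr fun N => ?_
    simp only [Function.comp_apply]
    rw [mul_comm, ← div_eq_mul_inv, Nat.floor_div_eq_div]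
  refine ((h.comp hdiv).mul h1).congr' ?_
  filter_upwards [hdiv.eventually_gt_atTop 0] with N hN
  have : ((N / (t + 1) : ℕ) : ℝ) ≠ 0 := by exact_mod_cast hN.ne'
  simp only [Function.comp_apply]
  rw [div_mul_div_cancel₀ this]

theorem exists_tendsto_g (s : ℕ) :
    ∃ α : ℝ, Tendsto (fun N : ℕ => (g s N : ℝ) / N) atTop (𝓝 α) := by
  obtain ⟨ρ, hρ⟩ := exists_tendsto_rough_density s
  refine ⟨∑' t, jump s t * (ρ * ((t + 1 : ℕ) : ℝ)⁻¹), ?_⟩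
  have h := tendsto_tsum_of_dominated_convergence (𝓕 := atTop)
    (f := fun (N : ℕ) t => jump s t * (((roughUpTo s (N / (t + 1))).card : ℝ) / N))
    (g := fun t => jump s t * (ρ * ((t + 1 : ℕ) : ℝ)⁻¹)) (summable_smooth_inv s)
    (fun t => (tendsto_rough_div s hρ t).const_mul _) (Eventually.of_forall fun N t => ?_)
  · refine h.congr fun N => ?_
    rw [g_eq_tsum, ← tsum_div_const]
    simp only [mul_div_assoc]
  · rw [Real.norm_of_nonneg (mul_nonneg (jump_nonneg s t) (by positivity))]
    have h1 : ((roughUpTo s (N / (t + 1))).card : ℝ) / N ≤ ((t + 1 : ℕ) : ℝ)⁻¹ := by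
      have h2 : ((roughUpTo s (N / (t + 1))).card : ℝ) ≤ (N : ℝ) / (t + 1 : ℕ) :=
        (Nat.cast_le.2 (card_roughUpTo_le s _)).trans Nat.cast_div_le
      refine div_le_of_le_mul₀ (Nat.cast_nonneg N) (by positivity) (h2.trans_eq ?_)
      rw [div_eq_mul_inv, mul_comm]
    refine (mul_le_mul (jump_le_indicator s t) h1 (by positivity)
      (Set.indicator_nonneg (fun _ _ => zero_le_one) _)).trans_eq ?_
    by_cases hs : t + 1 ∈ Nat.smoothNumbers (s + 1)
    · rw [Set.indicator_of_mem hs, Set.indicator_of_mem hs, one_mul]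
    · rw [Set.indicator_of_notMem hs, Set.indicator_of_notMem hs, zero_mul]

theorem tendsto_g (s : ℕ) :
    Tendsto (fun N : ℕ => (g s N : ℝ) / N) atTop (𝓝 (alphaBarSmooth s)) :=
  tendsto_nhds_limUnder (exists_tendsto_g s)

/-! ### Comparison of the two extremal problems -/

/-- The set `A` without the multiples of squares of primes exceeding `s`. -/
def squareSieve (s : ℕ) (A : Set ℕ) : Set ℕ :=
  {n ∈ A | ∀ p : ℕ, p.Prime → s < p → ¬ p ^ 2 ∣ n}

/-- From `c * den ^ 2 = a * num ^ 2` in lowest terms, a prime `p > s` in the numerator gives `p ^ 2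
∣ c`, and one in the denominator gives `p ^ 2 ∣ a`. -/
theorem gpFree_squareSieve {s : ℕ} {A : Set ℕ} (h : FreeOfRatios (smoothRatios s) A) :
    GPFree (squareSieve s A) := by
  rintro ⟨a, ha, b, hb, c, hc, k, -, hk1, h1, h2⟩
  have hk0 : 0 < k := zero_lt_one.trans hk1
  by_cases hk : k ∈ smoothRatios s
  · exact h ⟨a, ha.1, b, hb.1, c, hc.1, k, hk, hk1, h1, h2⟩
  · simp only [smoothRatios, Set.mem_ofPred_eq, not_forall, not_le] at hk
    obtain ⟨p, hp, hdvd, hps⟩ := hk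
    have e1 := mul_den_eq_mul_num hk0 h1
    have e2 : c * k.den = b * k.num.natAbs := mul_den_eq_mul_num hk0 (by rw [h2, h1]; ring)
    have e : c * k.den ^ 2 = a * k.num.natAbs ^ 2 := by
      calc c * k.den ^ 2 = (c * k.den) * k.den := by ring
        _ = (b * k.den) * k.num.natAbs := by rw [e2]; ring
        _ = _ := by rw [e1]; ring
    have hred : k.num.natAbs.Coprime k.den := k.reduced
    rcases hdvd with hd | hd
    · refine hc.2 p hp hps ?_
      have hcop : (p ^ 2).Coprime (k.den ^ 2) := (hred.coprime_dvd_left hd).pow 2 2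
      exact hcop.dvd_of_dvd_mul_right (e ▸ (pow_dvd_pow_of_dvd hd 2).mul_left a)
    · refine ha.2 p hp hps ?_
      have hcop : (p ^ 2).Coprime (k.num.natAbs ^ 2) := (hred.symm.coprime_dvd_left hd).pow 2 2
      exact hcop.dvd_of_dvd_mul_right (e ▸ (pow_dvd_pow_of_dvd hd 2).mul_left c)

/-- Letting `m` run over all integers above `s`, not only primes, suffices: the sum of `1 / m ^ 2`
is below `1 / s`. -/
theorem card_multiples_sq_le {s : ℕ} (hs : s ≠ 0) (N : ℕ) :
    ((((Finset.Ioc s N).biUnion fun m => (Finset.Ioc 0 N).filter (m ^ 2 ∣ ·)).card : ℕ) : ℝ) ≤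
      N / s := by
  have h1 : ((((Finset.Ioc s N).biUnion fun m =>
      (Finset.Ioc 0 N).filter (m ^ 2 ∣ ·)).card : ℕ) : ℝ) ≤
      ∑ m ∈ Finset.Ioc s N, (N : ℝ) * ((m : ℝ) ^ 2)⁻¹ := by
    refine (Nat.cast_le.2 Finset.card_biUnion_le).trans ?_
    push_cast
    refine Finset.sum_le_sum fun m _ => ?_
    rw [Nat.Ioc_filter_dvd_card_eq_div]
    exact Nat.cast_div_le.trans_eq (by push_cast; rw [div_eq_mul_inv])
  refine h1.trans ?_
  rw [← Finset.mul_sum, div_eq_mul_inv]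
  refine mul_le_mul_of_nonneg_left ?_ (Nat.cast_nonneg N)
  rcases le_total s N with h | h
  · refine (sum_Ioc_inv_sq_le_sub hs h).trans ?_
    have : (0 : ℝ) ≤ (N : ℝ)⁻¹ := by positivity
    linarith
  · rw [Finset.Ioc_eq_empty (by omega)]
    simp

open Classical in
/-- A large subset of `{1, …, N}` that is free of all geometric progressions. -/
theorem exists_gpFree_card_ge {s : ℕ} (hs : s ≠ 0) (N : ℕ) :
    ∃ A ⊆ Finset.Icc 1 N, GPFree (A : Set ℕ) ∧ (g s N : ℝ) - N / s ≤ A.card := by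
  obtain ⟨A, hA, hf, hc⟩ := exists_card_eq_maxFree (smoothRatios s) (Finset.Icc 1 N)
  set M := (Finset.Ioc s N).biUnion fun m => (Finset.Ioc 0 N).filter (m ^ 2 ∣ ·) with hM
  refine ⟨A \ M, Finset.sdiff_subset.trans hA, (gpFree_squareSieve hf).mono ?_, ?_⟩
  · intro n hn
    simp only [Finset.coe_sdiff, Set.mem_sdiff, Finset.mem_coe] at hn
    refine ⟨hn.1, fun p hp hps hd => hn.2 ?_⟩
    have hnN := Finset.mem_Icc.1 (hA hn.1)
    have hle := Nat.le_of_dvd (by omega) hd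
    have hp2 : p ≤ p ^ 2 := Nat.le_self_pow two_ne_zero p
    simp only [hM, Finset.mem_biUnion, Finset.mem_filter, Finset.mem_Ioc]
    exact ⟨p, ⟨hps, by omega⟩, ⟨by omega, hnN.2⟩, hd⟩
  · have h1 := card_multiples_sq_le hs N
    have h2 : (A.card : ℝ) ≤ (A \ M).card + M.card := by
      have := Finset.le_card_sdiff M A
      exact_mod_cast (by omega : A.card ≤ (A \ M).card + M.card)
    rw [g_eq_maxFree, ← hc]
    linarith

/-! ### A progression-free set of large upper density -/

theorem mul_eq_sq_of_ratio {a b c : ℕ} {k : ℚ} (h1 : (b : ℚ) = a * k) (h2 : (c : ℚ) = a * k ^ 2) :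
    a * c = b * b := by
  have : (a : ℚ) * c = b * b := by rw [h1, h2]; ring
  exact_mod_cast this

/-- The part of `⋃ j, A j` obtained by keeping of `A j` only the elements of `(u j, u (j + 1)]`
that form no square with a factor `a ≤ u j`. -/
def glue (u : ℕ → ℕ) (A : ℕ → Set ℕ) : Set ℕ :=
  {n | ∃ j, n ∈ A j ∧ u j < n ∧ n ≤ u (j + 1) ∧
    ∀ a ∈ Finset.Icc 1 (u j), ¬ IsSquare (a * n)}

/-- In a progression `a * c` is the square of `b`. If `a` lies in an earlier block than `c`, this
contradicts the condition on `c`; otherwise all three terms share a block. -/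
theorem gpFree_glue {u : ℕ → ℕ} (hu : Monotone u) {A : ℕ → Set ℕ} (hA : ∀ j, GPFree (A j)) :
    GPFree (glue u A) := by
  rintro ⟨a, ⟨i, ai, hai, hai', -⟩, b, ⟨l, bl, hbl, hbl', -⟩, c, ⟨j, cj, hcj, hcj', hsq⟩,
    k, hkR, hk1, h1, h2⟩
  have ha0 : (0 : ℚ) < a := by exact_mod_cast (Nat.zero_le _).trans_lt hai
  have hab : a < b := by
    have : (a : ℚ) < b := by rw [h1]; nlinarith
    exact_mod_cast this
  have hbc : b < c := by
    have : (b : ℚ) < c := by rw [h1, h2]; nlinarith [mul_pos ha0 (zero_lt_one.trans hk1)]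
    exact_mod_cast this
  -- Blocks are consecutive intervals, so block indices increase weakly with the elements.
  have key : ∀ {x y i j}, u i < x → x < y → y ≤ u (j + 1) → i ≤ j := by
    intro x y i j h h' h''
    by_contra! hlt
    have := hu (Nat.succ_le_of_lt hlt)
    simp only [Nat.succ_eq_add_one] at this
    omega
  have hij : i ≤ j := key hai (hab.trans hbc) hcj'
  rcases hij.lt_or_eq with hlt | rfl
  · refine hsq a (Finset.mem_Icc.2 ⟨by omega, hai'.trans (hu hlt)⟩) ⟨b, mul_eq_sq_of_ratio h1 h2⟩
  · have hl : l = i := le_antisymm (key hbl hbc hcj') (key hai hab hbl')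
    subst hl
    exact hA l ⟨a, ai, b, bl, c, cj, k, hkR, hk1, h1, h2⟩

/-- If `a * n = r * r`, then `n` is determined by `(a, r)`, and `r * r ≤ N ^ 7` forces `r ≤ N ^ 4`.
The exponent 6 makes the resulting `N ^ 5` pairs negligible. -/
theorem card_mul_isSquare_le (N : ℕ) :
    ((Finset.Icc 1 (N ^ 6)).filter fun n => ∃ a ∈ Finset.Icc 1 N, IsSquare (a * n)).card ≤
      N ^ 5 := by
  have hsub : ((Finset.Icc 1 (N ^ 6)).filter fun n => ∃ a ∈ Finset.Icc 1 N, IsSquare (a * n)) ⊆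
      (Finset.Icc 1 N ×ˢ Finset.Icc 1 (N ^ 4)).image fun x => x.2 * x.2 / x.1 := by
    intro n hn
    simp only [Finset.mem_filter, Finset.mem_Icc] at hn
    obtain ⟨⟨hn1, hn2⟩, a, ⟨ha1, ha2⟩, r, hr⟩ := hn
    refine Finset.mem_image.2 ⟨(a, r), ?_, ?_⟩
    · simp only [Finset.mem_product, Finset.mem_Icc]
      refine ⟨⟨ha1, ha2⟩, ?_, ?_⟩
      · by_contra! h
        have : r = 0 := by omega
        subst this
        have := Nat.mul_pos ha1 hn1
        omega
      · refine Nat.mul_self_le_mul_self_iff.1 ?_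
        rw [← hr]
        have hN : 1 ≤ N := ha1.trans ha2
        calc a * n ≤ N * N ^ 6 := Nat.mul_le_mul ha2 hn2
          _ = N ^ 7 := by ring
          _ ≤ N ^ 8 := Nat.pow_le_pow_right hN (by norm_num)
          _ = N ^ 4 * N ^ 4 := by ring
    · simp only [← hr]
      exact Nat.mul_div_cancel_left n ha1
  refine (Finset.card_le_card hsub).trans (Finset.card_image_le.trans_eq ?_)
  simp only [Finset.card_product, Nat.card_Icc, Nat.add_sub_cancel]
  ring

open Classical in
/-- The proportion of `{1, …, N}` that lies in `A`. -/
noncomputable def density (A : Set ℕ) (N : ℕ) : ℝ :=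
  (((Finset.Icc 1 N).filter (fun n => n ∈ A)).card : ℝ) / N

theorem upperDensity_eq (A : Set ℕ) : upperDensity A = limsup (density A) atTop := rfl

theorem density_nonneg (A : Set ℕ) (N : ℕ) : 0 ≤ density A N := by
  unfold density; positivity

theorem density_le_one (A : Set ℕ) (N : ℕ) : density A N ≤ 1 := by
  classical
  refine div_le_one_of_le₀ ?_ (Nat.cast_nonneg N)
  exact_mod_cast (Finset.card_filter_le _ _).trans (by simp)

theorem density_glue_ge {s : ℕ} {u : ℕ → ℕ} (hu : ∀ j, u (j + 1) = u j ^ 6) {j : ℕ}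
    (hj : 0 < u j) {A : ℕ → Finset ℕ} (hA : A j ⊆ Finset.Icc 1 (u (j + 1)))
    (hcard : (g s (u (j + 1)) : ℝ) - u (j + 1) / s ≤ (A j).card) :
    (g s (u (j + 1)) : ℝ) / u (j + 1) - 1 / s - 2 / u j ≤
      density (glue u fun j => (A j : Set ℕ)) (u (j + 1)) := by
  classical
  set S := (Finset.Icc 1 (u j ^ 6)).filter fun n => ∃ a ∈ Finset.Icc 1 (u j), IsSquare (a * n)
    with hS
  set F := (Finset.Icc 1 (u (j + 1))).filter fun n => n ∈ glue u fun j => (A j : Set ℕ) with hF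
  -- Gluing loses only the square-forming elements and those up to `u j`.
  have hsub : A j ⊆ F ∪ (S ∪ Finset.Icc 1 (u j)) := by
    intro n hn
    have hnN := Finset.mem_Icc.1 (hA hn)
    simp only [Finset.mem_union]
    by_cases h1 : n ≤ u j
    · exact Or.inr (Or.inr (Finset.mem_Icc.2 ⟨hnN.1, h1⟩))
    by_cases h2 : ∃ a ∈ Finset.Icc 1 (u j), IsSquare (a * n)
    · exact Or.inr (Or.inl (Finset.mem_filter.2 ⟨hu j ▸ hA hn, h2⟩))
    · refine Or.inl (Finset.mem_filter.2 ⟨hA hn, j, hn, not_le.1 h1, hnN.2, ?_⟩)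
      simpa only [not_exists, not_and] using h2
  have h1 : (A j).card ≤ F.card + (u j ^ 5 + u j) := by
    refine (Finset.card_le_card hsub).trans ((Finset.card_union_le _ _).trans ?_)
    refine Nat.add_le_add_left ((Finset.card_union_le _ _).trans ?_) _
    exact Nat.add_le_add (card_mul_isSquare_le (u j)) (by simp)
  have h2 : u j ≤ u j ^ 5 := Nat.le_self_pow (by norm_num) _
  have h3 : ((A j).card : ℝ) ≤ F.card + 2 * (u j : ℝ) ^ 5 := by
    exact_mod_cast (by omega : (A j).card ≤ F.card + 2 * u j ^ 5)
  have hx : (0 : ℝ) < u j := by exact_mod_cast hj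
  have hy : (u (j + 1) : ℝ) = (u j : ℝ) ^ 6 := by rw [hu]; push_cast; rfl
  have hy0 : (0 : ℝ) < u (j + 1) := by rw [hy]; positivity
  change _ ≤ (F.card : ℝ) / u (j + 1)
  rw [le_div_iff₀ hy0]
  have e : ((g s (u (j + 1)) : ℝ) / u (j + 1) - 1 / s - 2 / u j) * u (j + 1) =
      g s (u (j + 1)) - u (j + 1) / s - 2 * (u j : ℝ) ^ 5 := by
    have e1 : (2 / (u j : ℝ)) * u (j + 1) = 2 * (u j : ℝ) ^ 5 := by rw [hy]; field_simp
    rw [sub_mul, sub_mul, div_mul_cancel₀ _ hy0.ne', e1]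
    ring
  rw [e]
  linarith

theorem le_limsup_density {A : Set ℕ} {v : ℕ → ℕ} (hv : Tendsto v atTop atTop) {f : ℕ → ℝ} {c : ℝ}
    (hf : Tendsto f atTop (𝓝 c)) (h : ∀ j, f j ≤ density A (v j)) : c ≤ upperDensity A := by
  refine le_of_forall_lt fun d hd => ?_
  -- The intermediate value absorbs the loss of strictness in passing to the limsup.
  obtain ⟨d', hd', hd''⟩ := exists_between hd
  refine hd'.trans_le (le_limsup_of_frequently_le ?_
    (isBoundedUnder_of ⟨1, density_le_one A⟩))
  refine hv.frequently (Eventually.frequently ?_)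
  filter_upwards [hf.eventually_const_lt hd''] with j hj
  exact hj.le.trans (h j)

theorem exists_gpFree_upperDensity_ge {s : ℕ} (hs : s ≠ 0) :
    ∃ A : Set ℕ, (∀ n ∈ A, 0 < n) ∧ GPFree A ∧ alphaBarSmooth s - 1 / s ≤ upperDensity A := by
  let u : ℕ → ℕ := fun j => 2 ^ 6 ^ j
  have hu : ∀ j, u (j + 1) = u j ^ 6 := fun j => by simp only [u, pow_succ, pow_mul]
  have hpos : ∀ j, 0 < u j := fun j => by positivity
  have hstrict : StrictMono u := fun i j h =>
    Nat.pow_lt_pow_right one_lt_two (Nat.pow_lt_pow_right (by norm_num) h)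
  choose A hA hfree hcard using fun j => exists_gpFree_card_ge hs (u (j + 1))
  refine ⟨glue u fun j => (A j : Set ℕ), ?_, gpFree_glue hstrict.monotone hfree, ?_⟩
  · rintro n ⟨j, -, hj, -⟩
    exact (Nat.zero_le _).trans_lt hj
  · have hv : Tendsto (fun j => u (j + 1)) atTop atTop :=
      hstrict.tendsto_atTop.comp (tendsto_add_atTop_nat 1)
    have h2 : Tendsto (fun j => 2 / (u j : ℝ)) atTop (𝓝 0) :=
      (tendsto_const_div_atTop_nhds_zero_nat 2).comp hstrict.tendsto_atTop
    have h := (((tendsto_g s).comp hv).sub_const (1 / (s : ℝ))).sub h2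
    rw [sub_zero] at h
    exact le_limsup_density hv h fun j => density_glue_ge hu (hpos j) (hA j) (hcard j)

theorem upperDensity_le_one (A : Set ℕ) : upperDensity A ≤ 1 :=
  limsup_le_of_le (isBoundedUnder_of ⟨0, density_nonneg A⟩).isCoboundedUnder_le
    (Eventually.of_forall (density_le_one A))

theorem upperDensity_le_alphaBarSmooth {A : Set ℕ} (hA : GPFree A) (s : ℕ) :
    upperDensity A ≤ alphaBarSmooth s := by
  classical
  rw [← (tendsto_g s).limsup_eq, upperDensity_eq]
  refine limsup_le_limsup (Eventually.of_forall fun N => ?_)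
    (isBoundedUnder_of ⟨0, density_nonneg A⟩).isCoboundedUnder_le (tendsto_g s).isBoundedUnder_le
  refine div_le_div_of_nonneg_right ?_ (Nat.cast_nonneg N)
  rw [g_eq_maxFree]
  refine Nat.cast_le.2 (card_le_maxFree (Finset.filter_subset _ _) ?_)
  rintro ⟨a, ha, b, hb, c, hc, k, -, hk⟩
  simp only [Finset.coe_filter, Set.mem_ofPred_eq] at ha hb hc
  exact hA ⟨a, ha.2, b, hb.2, c, hc.2, k, Set.mem_univ k, hk⟩

theorem alphaBar_le_alphaBarSmooth (s : ℕ) : alphaBar ≤ alphaBarSmooth s := by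
  refine csSup_le ⟨_, ∅, by simp, FreeOfRatios.empty _, rfl⟩ ?_
  rintro d ⟨A, -, hA, rfl⟩
  exact upperDensity_le_alphaBarSmooth hA s

theorem alphaBarSmooth_sub_le_alphaBar {s : ℕ} (hs : s ≠ 0) :
    alphaBarSmooth s - 1 / s ≤ alphaBar := by
  obtain ⟨A, hpos, hA, h⟩ := exists_gpFree_upperDensity_ge hs
  refine h.trans (le_csSup ⟨1, ?_⟩ ⟨A, hpos, hA, rfl⟩)
  rintro d ⟨B, -, -, rfl⟩
  exact upperDensity_le_one B

end GeomProg

theorem mainTheorem2 :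
    (∀ s : ℕ, 2 ≤ s →
      Tendsto (fun N : ℕ => (GeomProg.g s N : ℝ) / (N : ℝ)) atTop
        (𝓝 (GeomProg.alphaBarSmooth s))) ∧
    Tendsto (fun s : ℕ => GeomProg.alphaBarSmooth s) atTop (𝓝 GeomProg.alphaBar) := by
  refine ⟨fun s _ => GeomProg.tendsto_g s, ?_⟩
  have h : Tendsto (fun s : ℕ => GeomProg.alphaBar + 1 / (s : ℝ)) atTop (𝓝 GeomProg.alphaBar) := by
    simpa using tendsto_one_div_atTop_nhds_zero_nat.const_add GeomProg.alphaBar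
  refine tendsto_of_tendsto_of_tendsto_of_le_of_le' tendsto_const_nhds h
    (Eventually.of_forall GeomProg.alphaBar_le_alphaBarSmooth) ?_
  filter_upwards [eventually_ne_atTop 0] with s hs
  have := GeomProg.alphaBarSmooth_sub_le_alphaBar hs
  linarith
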